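/- A \emph{$q$-query quantum algorithm} on inputs $x\in\{0,1\}^n$ acts on basis states $|i,y,z\rangle$, where $i$ is an index register of $\lceil\log_2 n\rceil$ qubits, $y$ is one qubit and $z$ is a work register of any finite number of qubits. It prepares $U_q O_x U_{q-1} O_x\cdots O_x U_0|0\cdots 0\rangle$, where $U_0,\dots,U_q$ are arbitrary unitaries that do not depend on $x$ and $O_x|i,y,z\rangle=|i,y\oplus x_i,z\rangle$ (with $x_i=0$ for addresses $i$ outside the input), measures in the computational basis, and accepts if the outcome lies in a fixed set. For $P\subseteq\{0,1\}^n$ and $\varepsilon>0$, such an algorithm is a \emph{quantum property tester for $P$ with distance parameter $\varepsilon$} if it accepts every $x\in P$ with probability at least $2/3$, and accepts with probability at most $1/3$ every $x\in\{0,1\}^n$ whose Hamming distance to each element of $P$ exceeds $\varepsilon n$. \textbf{Theorem.} Most properties containing $2^{n/20}$ elements of $\{0,1\}^n$ require quantum property testers using $\Omega(n)$ queries. That is, there are constants $\varepsilon_0>0$ and $c>0$ such that, as $n\to\infty$, the fraction of those subsets $P\subseteq\{0,1\}^n$ with $|P|=\lfloor 2^{n/20}\rfloor$ for which, for every $0<\varepsilon\le\varepsilon_0$,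 every quantum property tester for $P$ with distance parameter $\varepsilon$ makes at least $cn$ queries, tends to $1$. -/

import Mathlib

open Filter Topology

/-- Computational basis states `|i, y, z⟩` of a query algorithm on inputs of length `n`: an index
register `i` of `⌈log₂ n⌉` qubits (read as a binary number), one answer qubit `y`, and a work
register `z` of `w` qubits. -/
abbrev QueryBasis (n w : ℕ) : Type :=
  Fin (2 ^ Nat.clog 2 n) × Bool × (Fin w → Bool)

/-- The bit of the input `x` at address `i`; addresses `i ≥ n`, which exist when `n` is not a power
of two, carry the bit `0`. -/
def inputBit {n : ℕ} (x : Fin n → Bool) (i : ℕ) : Bool :=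
  if h : i < n then x ⟨i, h⟩ else false

/-- The permutation `(i, y, z) ↦ (i, y ⊕ xᵢ, z)` of the basis states. -/
def oraclePerm {n : ℕ} (w : ℕ) (x : Fin n → Bool) : Equiv.Perm (QueryBasis n w) :=
  Function.Involutive.toPerm
    (fun s => (s.1, xor s.2.1 (inputBit x s.1), s.2.2))
    (fun s => by simp)

/-- The oracle `O_x`, the linear map with `O_x |i, y, z⟩ = |i, y ⊕ xᵢ, z⟩`, acting on a vector of
amplitudes. -/
def applyOracle {n w : ℕ} (x : Fin n → Bool) (ψ : QueryBasis n w → ℂ) : QueryBasis n w → ℂ :=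
  fun s => ψ ((oraclePerm w x).symm s)

/-- A quantum query algorithm on inputs from `{0,1}ⁿ`: the number of work qubits, the number of
queries, the input-independent unitaries applied between the queries (only those with index
`≤ queries` are ever used), and the set of outcomes of the final measurement in the computational
basis on which it accepts. -/
structure QuantumQueryAlgorithm (n : ℕ) where
  workQubits : ℕ
  queries : ℕ
  unitary : ℕ → Matrix.unitaryGroup (QueryBasis n workQubits) ℂ
  accept : Finset (QueryBasis n workQubits)

namespace QuantumQueryAlgorithm

variable {n : ℕ}

/-- The state `U_t O_x U_{t-1} O_x ⋯ O_x U_0 |0…0⟩` reached after `t` queries. -/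
noncomputable def state (A : QuantumQueryAlgorithm n) (x : Fin n → Bool) :
    ℕ → QueryBasis n A.workQubits → ℂ
  | 0 => Matrix.mulVec (A.unitary 0).1 (Pi.single (0, false, fun _ => false) 1)
  | t + 1 => Matrix.mulVec (A.unitary (t + 1)).1 (applyOracle x (A.state x t))

/-- The probability that `A` accepts the input `x`. -/
noncomputable def acceptProb (A : QuantumQueryAlgorithm n) (x : Fin n → Bool) : ℝ :=
  ∑ s ∈ A.accept, ‖A.state x A.queries s‖ ^ 2

/-- `A` is a quantum property tester for `P` at distance parameter `ε`: it accepts every `x ∈ P`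
with probability at least `2/3`, and accepts with probability at most `1/3` every `x` that differs
from each element of `P` in more than `ε n` positions. -/
def IsTester (A : QuantumQueryAlgorithm n) (P : Finset (Fin n → Bool)) (ε : ℝ) : Prop :=
  (∀ x ∈ P, 2 / 3 ≤ A.acceptProb x) ∧
    ∀ x : Fin n → Bool, (∀ y ∈ P, ε * n < (hammingDist x y : ℝ)) → A.acceptProb x ≤ 1 / 3

end QuantumQueryAlgorithm

/-- Every quantum property tester for `P` at distance parameter `ε` makes at least `q` queries. -/
def RequiresQuantumQueries {n : ℕ} (P : Finset (Fin n → Bool)) (ε q : ℝ) : Prop :=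
  ∀ A : QuantumQueryAlgorithm n, A.IsTester P ε → q ≤ A.queries

/-- The properties of `{0,1}ⁿ` with `2^{n/20}` elements (rounded down). -/
def propertiesOfSize (n : ℕ) : Set (Finset (Fin n → Bool)) :=
  {P | P.card = ⌊(2 : ℝ) ^ ((n : ℝ) / 20)⌋₊}

/-!
The acceptance probability of a `q`-query algorithm is a real polynomial of degree at most `2 q` in
the input bits (`QuantumQueryAlgorithm.acceptProb_mem_polyDegLE`). If `2 q ≤ d` with `d = n / 1024`,
the set `F` of inputs accepted with probability at least `1/2` is therefore a superlevel set of an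
element of the space `polyDegLE n d`, whose dimension is at most the number `D` of subsets of `Fin n`
of size at most `d`. Superlevel sets of the elements of a `D`-dimensional space of functions shatter
no set of more than `D` points, so by the Sauer–Shelah lemma at most `(2 ^ n) ^ (D + 1)` sets `F`
occur, however many algorithms there are.

If the algorithm tests `P`, then `P ⊆ F` and `F` is covered by the Hamming balls of radius `d` around
the points of `P`, each of size `D`. So `F` has at most `m * D` elements, where `m = #P`, and only a
fraction of at most `(m * D / 2 ^ n) ^ m` of all `m`-element sets lies inside a given such `F`. An
entropy bound gives `D ≤ 2 ^ (n / 64)`, which is much smaller than `m ≈ 2 ^ (n / 20)`, so the union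
bound over all `F` leaves at most a fraction `2 ^ (-n)` of properties with a fast tester.
-/

/-! ### Superlevel sets of a finite-dimensional space of functions -/

section VapnikChervonenkis

open Finset

/-- A linear functional vanishing on the restriction of `W` to a larger set `T` has a sign pattern
that no element of `W` can oppose at every point of `T`. -/
theorem Finset.Shatters.card_le_finrank {α : Type*} [Fintype α] [DecidableEq α]
    {W : Submodule ℝ (α → ℝ)} {𝒜 : Finset (Finset α)}
    (h𝒜 : ∀ A ∈ 𝒜, ∃ p ∈ W, ∀ x, x ∈ A ↔ 0 ≤ p x) {T : Finset α} (hT : 𝒜.Shatters T) :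
    #T ≤ Module.finrank ℝ W := by
  by_contra! hlt
  let r : W →ₗ[ℝ] (T → ℝ) := (LinearMap.funLeft ℝ ℝ (Subtype.val : T → α)) ∘ₗ W.subtype
  have hr : LinearMap.range r < ⊤ := by
    refine lt_top_iff_ne_top.2 fun h => ?_
    have h1 := LinearMap.finrank_range_le r
    rw [h, finrank_top, Module.finrank_fintype_fun_eq_card, Fintype.card_coe] at h1
    omega
  obtain ⟨f, hf0, hf⟩ := Submodule.exists_le_ker_of_lt_top _ hr
  -- Up to a sign, `f` has a positive coefficient.
  obtain ⟨g, ⟨a, ha⟩, hg⟩ : ∃ g : (T → ℝ) →ₗ[ℝ] ℝ,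
      (∃ a, 0 < g (Pi.single a 1)) ∧ ∀ p : W, g (r p) = 0 := by
    have hker : ∀ p : W, f (r p) = 0 := fun p => hf (LinearMap.mem_range_self r p)
    obtain ⟨a, ha⟩ : ∃ a, f (Pi.single a 1) ≠ 0 := by
      by_contra! hall
      refine hf0 (LinearMap.pi_ext' fun a => LinearMap.ext_ring ?_)
      simpa using hall a
    rcases ha.lt_or_gt with h | h
    · exact ⟨-f, ⟨a, by simpa using h⟩, fun p => by simp [hker p]⟩
    · exact ⟨f, ⟨a, h⟩, hker⟩
  obtain ⟨A, hA, hTA⟩ := hT (t := (univ.filter fun x : T => g (Pi.single x 1) ≤ 0).map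
    (Function.Embedding.subtype _)) (by
      intro x hx
      obtain ⟨y, -, rfl⟩ := mem_map.1 hx
      exact y.2)
  obtain ⟨p, hpW, hp⟩ := h𝒜 A hA
  have hsign : ∀ x : T, 0 ≤ p x ↔ g (Pi.single x 1) ≤ 0 := by
    intro x
    have := Finset.ext_iff.1 hTA x
    rw [← hp]
    simpa using this
  have hsum : ∑ x : T, p x * g (Pi.single x 1) = 0 := by
    have := hg ⟨p, hpW⟩
    rw [LinearMap.pi_apply_eq_sum_univ] at this
    rw [← this]
    refine sum_congr rfl fun x _ => ?_
    have hx : (Pi.single x 1 : T → ℝ) = fun j => if x = j then 1 else 0 := by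
      funext j
      simp [Pi.single_apply, eq_comm]
    rw [hx]
    rfl
  have hneg : ∑ x : T, p x * g (Pi.single x 1) < 0 := by
    refine sum_neg' (fun x _ => ?_) ⟨a, mem_univ _, ?_⟩
    · rcases le_or_gt (g (Pi.single x 1)) 0 with h | h
      · exact mul_nonpos_of_nonneg_of_nonpos ((hsign x).2 h) h
      · exact mul_nonpos_of_nonpos_of_nonneg
          (not_le.1 fun h' => absurd ((hsign x).1 h') (not_le.2 h)).le h.le
    · exact mul_neg_of_neg_of_pos
        (not_le.1 fun h' => absurd ((hsign a).1 h') (not_le.2 ha)) ha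
  exact hneg.ne hsum

theorem Finset.card_superlevel_le {α : Type*} [Fintype α] [DecidableEq α]
    (hα : 2 ≤ Fintype.card α) {W : Submodule ℝ (α → ℝ)} {D : ℕ} (hW : Module.finrank ℝ W ≤ D)
    {𝒜 : Finset (Finset α)} (h𝒜 : ∀ A ∈ 𝒜, ∃ p ∈ W, ∀ x, x ∈ A ↔ 0 ≤ p x) :
    #𝒜 ≤ Fintype.card α ^ (D + 1) := by
  have hvc : 𝒜.vcDim ≤ D :=
    Finset.sup_le fun T hT => ((mem_shatterer.1 hT).card_le_finrank h𝒜).trans hW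
  calc #𝒜 ≤ #𝒜.shatterer := card_le_card_shatterer 𝒜
    _ ≤ ∑ k ∈ Iic 𝒜.vcDim, (Fintype.card α).choose k := card_shatterer_le_sum_vcDim
    _ ≤ ∑ k ∈ Iic 𝒜.vcDim, Fintype.card α ^ k := sum_le_sum fun k _ => Nat.choose_le_pow _ _
    _ ≤ Fintype.card α ^ (D + 1) :=
      (Nat.geomSum_lt hα fun k hk => Nat.lt_succ_of_le ((mem_Iic.1 hk).trans hvc)).le

end VapnikChervonenkis

/-! ### Real polynomials of bounded degree on the cube -/

section Polynomials

open Finset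

/-- The subsets of `Fin n` with at most `d` elements. -/
def lowWeight (n d : ℕ) : Finset (Finset (Fin n)) := univ.filter fun S => #S ≤ d

/-- The multilinear monomial `∏_{i ∈ S} xᵢ` as a real function on the cube. -/
def cubeMonomial {n : ℕ} (S : Finset (Fin n)) (x : Fin n → Bool) : ℝ :=
  if ∀ i ∈ S, x i = true then 1 else 0

/-- The functions on `{0,1}ⁿ` that are given by real polynomials of degree at most `d`. Since
`xᵢ² = xᵢ` on the cube, multilinear monomials suffice. -/
def polyDegLE (n d : ℕ) : Submodule ℝ ((Fin n → Bool) → ℝ) :=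
  Submodule.span ℝ ((lowWeight n d).image cubeMonomial : Finset _)

variable {n : ℕ}

theorem cubeMonomial_mem_polyDegLE {d : ℕ} {S : Finset (Fin n)} (hS : #S ≤ d) :
    cubeMonomial S ∈ polyDegLE n d :=
  Submodule.subset_span (by simpa [lowWeight] using ⟨S, hS, rfl⟩)

theorem cubeMonomial_mul (S T : Finset (Fin n)) :
    cubeMonomial S * cubeMonomial T = cubeMonomial (S ∪ T) := by
  funext x
  simp only [Pi.mul_apply, cubeMonomial, mem_union, or_imp, forall_and]
  split_ifs <;> simp_all

theorem finrank_polyDegLE_le (n d : ℕ) : Module.finrank ℝ (polyDegLE n d) ≤ #(lowWeight n d) :=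
  (finrank_span_finset_le_card _).trans card_image_le

theorem polyDegLE_mono {a b : ℕ} (h : a ≤ b) : polyDegLE n a ≤ polyDegLE n b := by
  refine Submodule.span_mono (coe_subset.2 (image_subset_image fun S hS => ?_))
  simp only [lowWeight, mem_filter, mem_univ, true_and] at hS ⊢
  exact hS.trans h

theorem mul_mem_polyDegLE {a b : ℕ} {f g : (Fin n → Bool) → ℝ} (hf : f ∈ polyDegLE n a)
    (hg : g ∈ polyDegLE n b) : f * g ∈ polyDegLE n (a + b) := by
  have h := Submodule.mul_mem_mul hf hg
  rw [polyDegLE, polyDegLE, Submodule.span_mul_span] at h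
  refine Submodule.span_le.2 ?_ h
  rintro _ ⟨_, hS, _, hT, rfl⟩
  simp only [coe_image, Set.mem_image, mem_coe, lowWeight, mem_filter, mem_univ, true_and] at hS hT
  obtain ⟨S, hS, rfl⟩ := hS
  obtain ⟨T, hT, rfl⟩ := hT
  simp only [cubeMonomial_mul]
  exact cubeMonomial_mem_polyDegLE ((card_union_le S T).trans (add_le_add hS hT))

theorem const_mem_polyDegLE (n d : ℕ) (c : ℝ) : (fun _ => c) ∈ polyDegLE n d := by
  have h := (polyDegLE n d).smul_mem c
    (cubeMonomial_mem_polyDegLE (S := (∅ : Finset (Fin n))) (by simp))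
  convert h using 1
  funext x
  simp [cubeMonomial]

theorem inputBit_mem_polyDegLE (i : ℕ) :
    (fun x : Fin n → Bool => if inputBit x i = true then (1 : ℝ) else 0) ∈ polyDegLE n 1 := by
  by_cases h : i < n
  · have := cubeMonomial_mem_polyDegLE (S := ({⟨i, h⟩} : Finset (Fin n))) (d := 1) (by simp)
    convert this using 1
    funext x
    simp [cubeMonomial, inputBit, h]
  · simpa [inputBit, h] using const_mem_polyDegLE n 1 0

/-- Selecting between two polynomials by an input bit `b` is the polynomial `g + b * (f - g)`. -/
theorem ite_inputBit_mem_polyDegLE (i : ℕ) {t : ℕ} {f g : (Fin n → Bool) → ℝ}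
    (hf : f ∈ polyDegLE n t) (hg : g ∈ polyDegLE n t) :
    (fun x => if inputBit x i = true then f x else g x) ∈ polyDegLE n (t + 1) := by
  have h := (polyDegLE n (t + 1)).add_mem (polyDegLE_mono (Nat.le_succ t) hg)
    (mul_mem_polyDegLE (sub_mem hf hg) (inputBit_mem_polyDegLE i))
  convert h using 1
  funext x
  by_cases hx : inputBit x i = true <;> simp [hx]

end Polynomials

/-! ### Acceptance probabilities as polynomials -/

namespace QuantumQueryAlgorithm

open Finset

variable {n : ℕ}

theorem mulVec_re_im_mem_polyDegLE {d : ℕ} {ι : Type*} [Fintype ι] (U : Matrix ι ι ℂ)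
    {ψ : (Fin n → Bool) → ι → ℂ}
    (hψ : ∀ s, (fun x => (ψ x s).re) ∈ polyDegLE n d ∧ (fun x => (ψ x s).im) ∈ polyDegLE n d)
    (s : ι) : (fun x => (U.mulVec (ψ x) s).re) ∈ polyDegLE n d ∧
      (fun x => (U.mulVec (ψ x) s).im) ∈ polyDegLE n d := by
  constructor
  · have h := (polyDegLE n d).sum_mem (t := univ) fun s' _ => sub_mem
      ((polyDegLE n d).smul_mem (U s s').re (hψ s').1)
      ((polyDegLE n d).smul_mem (U s s').im (hψ s').2)
    convert h using 1
    funext x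
    simp [Matrix.mulVec, dotProduct, Complex.re_sum]
  · have h := (polyDegLE n d).sum_mem (t := univ) fun s' _ => add_mem
      ((polyDegLE n d).smul_mem (U s s').re (hψ s').2)
      ((polyDegLE n d).smul_mem (U s s').im (hψ s').1)
    convert h using 1
    funext x
    simp [Matrix.mulVec, dotProduct, Complex.im_sum]

theorem applyOracle_apply {w : ℕ} (x : Fin n → Bool) (ψ : QueryBasis n w → ℂ)
    (s : QueryBasis n w) : applyOracle x ψ s =
      if inputBit x s.1 = true then ψ (s.1, !s.2.1, s.2.2) else ψ s := by
  have h : applyOracle x ψ s = ψ (s.1, xor s.2.1 (inputBit x s.1), s.2.2) := rfl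
  rw [h]
  split_ifs with hx
  · simp [hx]
  · simp [Bool.eq_false_of_not_eq_true hx]

theorem applyOracle_re_im_mem_polyDegLE {d w : ℕ} {ψ : (Fin n → Bool) → QueryBasis n w → ℂ}
    (hψ : ∀ s, (fun x => (ψ x s).re) ∈ polyDegLE n d ∧ (fun x => (ψ x s).im) ∈ polyDegLE n d)
    (s : QueryBasis n w) : (fun x => (applyOracle x (ψ x) s).re) ∈ polyDegLE n (d + 1) ∧
      (fun x => (applyOracle x (ψ x) s).im) ∈ polyDegLE n (d + 1) := by
  simp only [applyOracle_apply, apply_ite Complex.re, apply_ite Complex.im]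
  exact ⟨ite_inputBit_mem_polyDegLE _ (hψ _).1 (hψ _).1,
    ite_inputBit_mem_polyDegLE _ (hψ _).2 (hψ _).2⟩

/-- After `t` queries every amplitude is a polynomial of degree at most `t` in the input. -/
theorem state_re_im_mem_polyDegLE (A : QuantumQueryAlgorithm n) (t : ℕ)
    (s : QueryBasis n A.workQubits) : (fun x => (A.state x t s).re) ∈ polyDegLE n t ∧
      (fun x => (A.state x t s).im) ∈ polyDegLE n t := by
  induction t generalizing s with
  | zero =>
    exact ⟨const_mem_polyDegLE n 0 (A.state (fun _ => false) 0 s).re,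
      const_mem_polyDegLE n 0 (A.state (fun _ => false) 0 s).im⟩
  | succ t ih => exact mulVec_re_im_mem_polyDegLE _ (applyOracle_re_im_mem_polyDegLE ih) s

/-- The polynomial method: acceptance after `q` queries is a polynomial of degree at most `2 q`. -/
theorem acceptProb_mem_polyDegLE (A : QuantumQueryAlgorithm n) :
    A.acceptProb ∈ polyDegLE n (2 * A.queries) := by
  have h := (polyDegLE n (2 * A.queries)).sum_mem (t := A.accept) fun s _ => by
    have hs := A.state_re_im_mem_polyDegLE A.queries s
    rw [two_mul]
    exact add_mem (mul_mem_polyDegLE hs.1 hs.1) (mul_mem_polyDegLE hs.2 hs.2)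
  convert h using 1
  funext x
  simp [acceptProb, Complex.sq_norm, Complex.normSq_apply]

theorem IsTester.mono {A : QuantumQueryAlgorithm n} {P : Finset (Fin n → Bool)} {ε ε' : ℝ}
    (h : A.IsTester P ε) (hε : ε ≤ ε') : A.IsTester P ε' :=
  ⟨h.1, fun x hx => h.2 x fun y hy =>
    (mul_le_mul_of_nonneg_right hε (Nat.cast_nonneg n)).trans_lt (hx y hy)⟩

end QuantumQueryAlgorithm

/-! ### Hamming balls and binomial coefficients -/

section Counting

open Finset

theorem card_hammingBall_le {n : ℕ} (y : Fin n → Bool) (d : ℕ) :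
    #(univ.filter fun x : Fin n → Bool => hammingDist x y ≤ d) ≤ #(lowWeight n d) := by
  refine card_le_card_of_injOn (fun x => univ.filter fun i => x i ≠ y i) (fun x hx => ?_)
    fun x _ x' _ h => ?_
  · simpa [lowWeight, hammingDist] using hx
  · funext i
    have hi := Finset.ext_iff.1 h i
    simp only [mem_filter, mem_univ, true_and] at hi
    revert hi
    cases x i <;> cases x' i <;> cases y i <;> simp

/-- The entropy bound for Hamming balls of relative radius `1 / 1024`: weighting a set `S` by
`t ^ #S` bounds the count by `t ^ (-d) * (1 + t) ^ n`, here with `t = 1 / 256`. -/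
theorem card_lowWeight_le (n : ℕ) :
    (#(lowWeight n (n / 1024)) : ℝ) ≤ (2 : ℝ) ^ ((n : ℝ) / 64) := by
  set d := n / 1024 with hd
  have h1 : (#(lowWeight n d) : ℝ) * (1 / 256) ^ d ≤ (1 / 256 + 1) ^ n := by
    calc (#(lowWeight n d) : ℝ) * (1 / 256) ^ d
        = ∑ S ∈ lowWeight n d, (1 / 256 : ℝ) ^ d := by simp
      _ ≤ ∑ S ∈ lowWeight n d, (1 / 256 : ℝ) ^ #S := sum_le_sum fun S hS =>
          pow_le_pow_of_le_one (by norm_num) (by norm_num) (mem_filter.1 hS).2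
      _ ≤ ∑ S : Finset (Fin n), (1 / 256 : ℝ) ^ #S :=
          sum_le_sum_of_subset_of_nonneg (subset_univ _) fun _ _ _ => by positivity
      _ = (1 / 256 + 1) ^ n := by
          simpa using Fintype.sum_pow_mul_eq_add_pow (Fin n) (1 / 256 : ℝ) 1
  have h2 : (1 / 256 + 1 : ℝ) ^ n ≤ (2 : ℝ) ^ ((n : ℝ) / 128) := by
    have h : (1 / 256 + 1 : ℝ) ^ 128 ≤ 2 := by norm_num
    calc (1 / 256 + 1 : ℝ) ^ n = ((1 / 256 + 1 : ℝ) ^ 128) ^ ((n : ℝ) / 128) := by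
          rw [← Real.rpow_natCast, ← Real.rpow_natCast, ← Real.rpow_mul (by norm_num)]
          congr 1
          push_cast
          ring
      _ ≤ _ := Real.rpow_le_rpow (by positivity) h (by positivity)
  have h3 : (256 : ℝ) ^ d ≤ (2 : ℝ) ^ ((n : ℝ) / 128) := by
    have h : (256 : ℝ) ^ d = (2 : ℝ) ^ ((8 * d : ℕ) : ℝ) := by
      rw [Real.rpow_natCast, pow_mul]
      norm_num
    rw [h]
    refine Real.rpow_le_rpow_of_exponent_le one_le_two ?_
    have h' : 1024 * d ≤ n := Nat.mul_div_le n 1024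
    have : (1024 * d : ℝ) ≤ n := by exact_mod_cast h'
    push_cast
    linarith
  calc (#(lowWeight n d) : ℝ) = #(lowWeight n d) * (1 / 256) ^ d * 256 ^ d := by
        rw [mul_assoc, ← mul_pow]
        norm_num
    _ ≤ (2 : ℝ) ^ ((n : ℝ) / 128) * (2 : ℝ) ^ ((n : ℝ) / 128) :=
        mul_le_mul (h1.trans h2) h3 (by positivity) (by positivity)
    _ = (2 : ℝ) ^ ((n : ℝ) / 64) := by
        rw [← Real.rpow_add two_pos]
        congr 1
        ring

/-- A set of `M` out of `N` points contains at most a fraction `(M / N) ^ m` of all `m`-element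
sets. -/
theorem Nat.choose_mul_pow_le {M N : ℕ} (h : M ≤ N) (m : ℕ) :
    M.choose m * N ^ m ≤ N.choose m * M ^ m := by
  have hdesc : M.descFactorial m * N ^ m ≤ N.descFactorial m * M ^ m := by
    induction m with
    | zero => simp
    | succ k ih =>
      have hk : (M - k) * N ≤ (N - k) * M := by
        rw [Nat.sub_mul, Nat.sub_mul, mul_comm M N]
        exact Nat.sub_le_sub_left (Nat.mul_le_mul_left k h) _
      calc M.descFactorial (k + 1) * N ^ (k + 1)
          = ((M - k) * N) * (M.descFactorial k * N ^ k) := by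
            rw [Nat.descFactorial_succ]
            ring
        _ ≤ ((N - k) * M) * (N.descFactorial k * M ^ k) := Nat.mul_le_mul hk ih
        _ = N.descFactorial (k + 1) * M ^ (k + 1) := by
            rw [Nat.descFactorial_succ]
            ring
  rw [Nat.descFactorial_eq_factorial_mul_choose, Nat.descFactorial_eq_factorial_mul_choose,
    mul_assoc, mul_assoc] at hdesc
  exact Nat.le_of_mul_le_mul_left hdesc m.factorial_pos

/-- The two comparisons of the property size `2 ^ (n / 20)` with the volume `D ≤ 2 ^ (n / 64)` of a
Hamming ball on which the union bound rests. -/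
theorem propertySize_bounds {n : ℕ} (hn : 128 ≤ n) :
    2 * #(lowWeight n (n / 1024)) + 4 ≤ ⌊(2 : ℝ) ^ ((n : ℝ) / 20)⌋₊ ∧
      (⌊(2 : ℝ) ^ ((n : ℝ) / 20)⌋₊ * #(lowWeight n (n / 1024))) ^ 2 ≤ 2 ^ n := by
  have hn' : (128 : ℝ) ≤ n := by exact_mod_cast hn
  have hD := card_lowWeight_le n
  set D := #(lowWeight n (n / 1024))
  constructor
  · refine Nat.le_floor ?_
    have hu : (4 : ℝ) ≤ (2 : ℝ) ^ ((n : ℝ) / 64) := by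
      calc (4 : ℝ) = (2 : ℝ) ^ (2 : ℝ) := by norm_num
        _ ≤ _ := Real.rpow_le_rpow_of_exponent_le one_le_two (by linarith)
    have hsq : (2 : ℝ) ^ ((n : ℝ) / 64) * (2 : ℝ) ^ ((n : ℝ) / 64) ≤ (2 : ℝ) ^ ((n : ℝ) / 20) := by
      rw [← Real.rpow_add two_pos]
      exact Real.rpow_le_rpow_of_exponent_le one_le_two (by linarith)
    push_cast
    nlinarith
  · have hm : (⌊(2 : ℝ) ^ ((n : ℝ) / 20)⌋₊ : ℝ) ≤ (2 : ℝ) ^ ((n : ℝ) / 20) :=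
      Nat.floor_le (by positivity)
    have : ((⌊(2 : ℝ) ^ ((n : ℝ) / 20)⌋₊ : ℝ) * D) ^ 2 ≤ 2 ^ n := by
      calc ((⌊(2 : ℝ) ^ ((n : ℝ) / 20)⌋₊ : ℝ) * D) ^ 2
          ≤ ((2 : ℝ) ^ ((n : ℝ) / 20) * (2 : ℝ) ^ ((n : ℝ) / 64)) ^ 2 := by gcongr
        _ = (2 : ℝ) ^ (((n : ℝ) / 20 + (n : ℝ) / 64) * (2 : ℕ)) := by
            rw [← Real.rpow_add two_pos, ← Real.rpow_mul_natCast two_pos.le]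
        _ ≤ (2 : ℝ) ^ (n : ℝ) :=
            Real.rpow_le_rpow_of_exponent_le one_le_two (by push_cast; linarith)
        _ = 2 ^ n := Real.rpow_natCast _ _
    exact_mod_cast this

end Counting

/-! ### Properties with a fast tester are rare -/

section UnionBound

open Finset

/-- The accepting set of a fast tester: it contains `P`, and lies in the union of the Hamming balls
of radius `n / 1024` around the points of `P`. -/
theorem exists_superlevel_of_not_requires {n : ℕ} {P : Finset (Fin n → Bool)} {ε : ℝ}
    (hε : ε ≤ 1 / 1024) (hP : ¬ RequiresQuantumQueries P ε (1 / 2048 * n)) :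
    ∃ F : Finset (Fin n → Bool), (∃ p ∈ polyDegLE n (n / 1024), ∀ x, x ∈ F ↔ 0 ≤ p x) ∧
      #F ≤ #P * #(lowWeight n (n / 1024)) ∧ P ⊆ F := by
  classical
  simp only [RequiresQuantumQueries, not_forall, not_le] at hP
  obtain ⟨A, hA, hq⟩ := hP
  have hA' := hA.mono hε
  have hq' : 2 * A.queries ≤ n / 1024 := by
    rw [Nat.le_div_iff_mul_le (by norm_num)]
    have : (2 * A.queries * 1024 : ℝ) ≤ n := by linarith
    exact_mod_cast this
  refine ⟨univ.filter fun x => 1 / 2 ≤ A.acceptProb x,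
    ⟨A.acceptProb - fun _ => 1 / 2, sub_mem (polyDegLE_mono hq' A.acceptProb_mem_polyDegLE)
      (const_mem_polyDegLE _ _ _), fun x => by simp⟩, ?_, fun x hx => ?_⟩
  · have hsub : (univ.filter fun x => 1 / 2 ≤ A.acceptProb x) ⊆
        P.biUnion fun y => univ.filter fun x => hammingDist x y ≤ n / 1024 := by
      intro x hx
      have hx : 1 / 2 ≤ A.acceptProb x := (mem_filter.1 hx).2
      by_contra hfar
      have h := hA'.2 x fun y hy => ?_
      · linarith
      · have hlt : n / 1024 < hammingDist x y := by
          by_contra! hle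
          exact hfar (mem_biUnion.2 ⟨y, hy, mem_filter.2 ⟨mem_univ _, hle⟩⟩)
        rw [Nat.div_lt_iff_lt_mul (by norm_num)] at hlt
        have : (n : ℝ) < hammingDist x y * 1024 := by exact_mod_cast hlt
        linarith
    exact (card_le_card hsub).trans
      (card_biUnion_le_card_mul _ _ _ fun y _ => card_hammingBall_le y _)
  · have := hA'.1 x hx
    exact mem_filter.2 ⟨mem_univ _, by linarith⟩

theorem propertiesOfSize_eq (n : ℕ) : propertiesOfSize n =
    (powersetCard ⌊(2 : ℝ) ^ ((n : ℝ) / 20)⌋₊ (univ : Finset (Fin n → Bool)) :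
      Set (Finset (Fin n → Bool))) := by
  ext P
  simp [propertiesOfSize]

theorem ncard_propertiesOfSize (n : ℕ) :
    (propertiesOfSize n).ncard = (2 ^ n).choose ⌊(2 : ℝ) ^ ((n : ℝ) / 20)⌋₊ := by
  rw [propertiesOfSize_eq, Set.ncard_coe_finset]
  simp

/-- The union bound over the superlevel sets `F` that can contain a property with a fast tester: at
most a fraction `2 ^ (-n)` of the properties has one. -/
theorem ncard_fastTestable_mul_le {n : ℕ} (hn : 128 ≤ n) :
    {P ∈ propertiesOfSize n | ¬ ∀ ε : ℝ, 0 < ε → ε ≤ 1 / 1024 →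
      RequiresQuantumQueries P ε (1 / 2048 * n)}.ncard * 2 ^ n ≤ (propertiesOfSize n).ncard := by
  classical
  obtain ⟨hDm, hmD⟩ := propertySize_bounds hn
  rw [ncard_propertiesOfSize]
  set B := {P ∈ propertiesOfSize n | ¬ ∀ ε : ℝ, 0 < ε → ε ≤ 1 / 1024 →
      RequiresQuantumQueries P ε (1 / 2048 * n)} with hB
  set m := ⌊(2 : ℝ) ^ ((n : ℝ) / 20)⌋₊ with hm
  set D := #(lowWeight n (n / 1024)) with hD
  set N := 2 ^ n with hN
  have hN1 : 1 ≤ N := Nat.one_le_two_pow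
  have hN2 : 2 ≤ Fintype.card (Fin n → Bool) := by
    simpa using Nat.pow_le_pow_right two_pos (show 1 ≤ n by omega)
  have hmDN : m * D ≤ N := (Nat.le_self_pow two_ne_zero _).trans hmD
  let 𝓕 : Finset (Finset (Fin n → Bool)) :=
    univ.filter fun F => ∃ p ∈ polyDegLE n (n / 1024), ∀ x, x ∈ F ↔ 0 ≤ p x
  have h𝓕 : #𝓕 ≤ N ^ (D + 1) := by
    have := card_superlevel_le hN2 (finrank_polyDegLE_le n (n / 1024)) (𝒜 := 𝓕)
      fun F hF => (mem_filter.1 hF).2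
    simpa using this
  have hBcard : B.ncard ≤ N ^ (D + 1) * (m * D).choose m := by
    have hsub : B ⊆ ((𝓕.filter fun F => #F ≤ m * D).biUnion (powersetCard m) :
        Finset (Finset (Fin n → Bool))) := by
      rintro P ⟨hPm, hP⟩
      have hPm : #P = m := hPm
      push Not at hP
      obtain ⟨ε, -, hε, hP⟩ := hP
      obtain ⟨F, hF, hFcard, hPF⟩ := exists_superlevel_of_not_requires hε hP
      rw [hPm] at hFcard
      exact mem_coe.2 (mem_biUnion.2 ⟨F, mem_filter.2 ⟨mem_filter.2 ⟨mem_univ _, hF⟩, hFcard⟩,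
        mem_powersetCard.2 ⟨hPF, hPm⟩⟩)
    have h1 := Set.ncard_le_ncard hsub (finite_toSet _)
    rw [Set.ncard_coe_finset] at h1
    refine h1.trans ((card_biUnion_le_card_mul _ _ ((m * D).choose m) fun F hF => ?_).trans
      (Nat.mul_le_mul_right _ ((card_filter_le _ _).trans h𝓕)))
    rw [card_powersetCard]
    exact Nat.choose_le_choose m (mem_filter.1 hF).2
  -- Squaring avoids the half-integral exponent in `m * D ≤ 2 ^ (n / 2)`.
  have hexp : N ^ (D + 1) * (m * D) ^ m * N ≤ N ^ m := by
    refine (Nat.pow_le_pow_iff_left two_ne_zero).1 ?_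
    calc (N ^ (D + 1) * (m * D) ^ m * N) ^ 2 = N ^ (2 * D + 4) * ((m * D) ^ 2) ^ m := by ring
      _ ≤ N ^ m * N ^ m :=
          Nat.mul_le_mul (Nat.pow_le_pow_right hN1 hDm) (Nat.pow_le_pow_left hmD m)
      _ = (N ^ m) ^ 2 := by ring
  refine Nat.le_of_mul_le_mul_right ?_ (pow_pos hN1 m)
  calc B.ncard * N * N ^ m ≤ N ^ (D + 1) * (m * D).choose m * N * N ^ m := by gcongr
    _ = N ^ (D + 1) * N * ((m * D).choose m * N ^ m) := by ring
    _ ≤ N ^ (D + 1) * N * (N.choose m * (m * D) ^ m) :=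
        Nat.mul_le_mul_left _ (Nat.choose_mul_pow_le hmDN m)
    _ = N.choose m * (N ^ (D + 1) * (m * D) ^ m * N) := by ring
    _ ≤ N.choose m * N ^ m := Nat.mul_le_mul_left _ hexp

theorem ncard_propertiesOfSize_pos (n : ℕ) : 0 < (propertiesOfSize n).ncard := by
  rw [ncard_propertiesOfSize]
  refine Nat.choose_pos (Nat.floor_le_of_le ?_)
  push_cast
  rw [← Real.rpow_natCast]
  refine Real.rpow_le_rpow_of_exponent_le one_le_two ?_
  linarith [Nat.cast_nonneg (α := ℝ) n]

end UnionBound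

theorem mainTheorem4 :
    ∃ ε₀ : ℝ, 0 < ε₀ ∧ ∃ c : ℝ, 0 < c ∧
      Tendsto
        (fun n : ℕ =>
          (Set.ncard {P ∈ propertiesOfSize n |
              ∀ ε : ℝ, 0 < ε → ε ≤ ε₀ → RequiresQuantumQueries P ε (c * n)} : ℝ) /
            (Set.ncard (propertiesOfSize n) : ℝ))
        atTop (𝓝 1) := by
  refine ⟨1 / 1024, by norm_num, 1 / 2048, by norm_num, ?_⟩
  have hlim : Tendsto (fun n : ℕ => 1 - (1 / 2 : ℝ) ^ n) atTop (𝓝 1) := by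
    simpa using (tendsto_pow_atTop_nhds_zero_of_lt_one (r := (1 / 2 : ℝ))
      (by norm_num) (by norm_num)).const_sub 1
  refine tendsto_of_tendsto_of_tendsto_of_le_of_le' hlim tendsto_const_nhds ?_ ?_
  · filter_upwards [eventually_ge_atTop 128] with n hn
    have hbad := ncard_fastTestable_mul_le hn
    have hfin : (propertiesOfSize n).Finite := Set.toFinite _
    have hsplit : (propertiesOfSize n).ncard ≤
        {P ∈ propertiesOfSize n | ∀ ε : ℝ, 0 < ε → ε ≤ 1 / 1024 →
          RequiresQuantumQueries P ε (1 / 2048 * n)}.ncard +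
        {P ∈ propertiesOfSize n | ¬ ∀ ε : ℝ, 0 < ε → ε ≤ 1 / 1024 →
          RequiresQuantumQueries P ε (1 / 2048 * n)}.ncard := by
      refine (Set.ncard_le_ncard (fun P hP => ?_) (Set.toFinite _)).trans (Set.ncard_union_le _ _)
      by_cases h : ∀ ε : ℝ, 0 < ε → ε ≤ 1 / 1024 → RequiresQuantumQueries P ε (1 / 2048 * n)
      · exact Or.inl ⟨hP, h⟩
      · exact Or.inr ⟨hP, h⟩
    have hpos : (0 : ℝ) < (propertiesOfSize n).ncard := by
      exact_mod_cast ncard_propertiesOfSize_pos n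
    generalize {P ∈ propertiesOfSize n | ¬ ∀ ε : ℝ, 0 < ε → ε ≤ 1 / 1024 →
      RequiresQuantumQueries P ε (1 / 2048 * n)}.ncard = b at hbad hsplit
    have hbad' : (b : ℝ) * 2 ^ n ≤ (propertiesOfSize n).ncard := by exact_mod_cast hbad
    have hsplit' : ((propertiesOfSize n).ncard : ℝ) ≤
        ({P ∈ propertiesOfSize n | ∀ ε : ℝ, 0 < ε → ε ≤ 1 / 1024 →
          RequiresQuantumQueries P ε (1 / 2048 * n)}.ncard : ℝ) + b := by exact_mod_cast hsplit
    have hb : (b : ℝ) ≤ (1 / 2) ^ n * (propertiesOfSize n).ncard := by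
      rw [one_div, inv_pow, inv_mul_eq_div, le_div_iff₀ (by positivity)]
      exact hbad'
    rw [le_div_iff₀ hpos]
    linarith
  · refine Eventually.of_forall fun n => div_le_one_of_le₀ ?_ (Nat.cast_nonneg _)
    exact Nat.cast_le.2 (Set.ncard_le_ncard (Set.sep_subset _ _) (Set.toFinite _))
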